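/- Let $\mathbb K$ be a field, let $d\ge 1$ be an integer, and let $V$ be a vector space over $\mathbb K$ of dimension $d+1$. Write $\mathcal A=\mathrm{End}(V)$. Let $\{E^*_i\}_{i=0}^d$ be elements of $\mathcal A$ of rank $1$ such that $E^*_iE^*_j=\delta_{i,j}E^*_i$ for $0\le i,j\le d$. Let $A\in\mathcal A$ satisfy, for $0\le i,j\le d$, $E^*_iAE^*_j=0$ if $|i-j|>1$ and $E^*_iAE^*_j\ne 0$ if $|i-j|=1$. Assume that $A$ is multiplicity-free, i.e. that it has $d+1$ mutually distinct eigenvalues $\theta_0,\dots,\theta_d$ in $\mathbb K$, and let $E_i$ be the primitive idempotent of $A$ for $\theta_i$: the element of $\mathcal A$ that is the identity on the $\theta_i$-eigenspace of $A$ and zero on the $\theta_j$-eigenspace for each $j\ne i$. Let $\theta^*_0,\dots,\theta^*_d\in\mathbb K$ be arbitrary scalars, and put $A^*=\sum_{i=0}^d\theta^*_iE^*_i$. A sequence $\{G_i\}_{i=0}^d$ is a *$Q$-polynomial ordering* of the primitive idempotents of $A$ if $(A;\{G_i\}_{i=0}^d;A^*;\{E^*_i\}_{i=0}^d)$ is a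 Leonard system, that is, if * $A$ and $A^*$ are multiplicity-free, * $\{G_i\}_{i=0}^d$ is an ordering of the primitive idempotents of $A$, and $\{E^*_i\}_{i=0}^d$ is an ordering of the primitive idempotents of $A^*$, * for $0\le i,j\le d$, both $E^*_iAE^*_j$ and $G_iA^*G_j$ are zero if $|i-j|>1$ and nonzero if $|i-j|=1$. An ordered pair $(E,F)$ of distinct primitive idempotents of $A$ is *$Q$-polynomial* if there is a $Q$-polynomial ordering $\{G_i\}_{i=0}^d$ of the primitive idempotents of $A$ with $G_0=E$ and $G_1=F$. Let $\Delta$ be the graph with vertex set $\{0,1,\dots,d\}$ in which $i$ and $j$ are adjacent if and only if $i\ne j$ and $E_iA^*E_j\ne 0$. (This relation is symmetric in the present setting.) An ordered pair $(E,F)=(E_i,E_j)$ with $i\neq j$ is a *tail* if, in $\Delta$, the vertex $i$ is adjacent to no vertex besides $j$, and $j$ is adjacent to at most one vertex besides $i$. **Theorem.** Let $(E,F)$ be an ordered pair of distinct primitive idempotents of $A$. Then $(E,F)$ is $Q$-polynomial if and only if the following three conditions hold. 1. $(E,F)$ is a tail. 2. There exists $\beta\in\mathbb K$ such that $\theta^*_{i-1}-\beta\theta^*_i+\theta^*_{i+1}$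 is independent of $i$ for $1\le i\le d-1$. 3. $\theta^*_0\ne\theta^*_i$ for $1\le i\le d$. -/

import Mathlib

namespace LeonardTail

variable {K V : Type*} [Field K] [AddCommGroup V] [Module K V] {d : ℕ}

/-- `A` is multiplicity-free: it has `dim V` mutually distinct eigenvalues in `K`. -/
def IsMultiplicityFree (A : Module.End K V) : Prop :=
  ∃ θ : Fin (Module.finrank K V) → K, Function.Injective θ ∧ ∀ i, A.HasEigenvalue (θ i)

/-- A system of mutually orthogonal idempotents of rank one, indexed by `0, …, d`
(on a space of dimension `d + 1`). -/
structure IsOrthogonalIdempotentSystem (E : Fin (d + 1) → Module.End K V) : Prop where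
  mul_eq : ∀ i j, E i * E j = if i = j then E i else 0
  rank_eq_one : ∀ i, Module.finrank K (LinearMap.range (E i)) = 1

/-- `E` is the primitive idempotent of the (multiplicity-free) map `A` for its eigenvalue `θ`:
the identity on the `θ`-eigenspace, and zero on every other eigenspace. -/
structure IsPrimitiveIdempotent (A : Module.End K V) (θ : K) (E : Module.End K V) : Prop where
  hasEigenvalue : A.HasEigenvalue θ
  apply_self : ∀ v ∈ A.eigenspace θ, E v = v
  apply_other : ∀ μ : K, μ ≠ θ → ∀ v ∈ A.eigenspace μ, E v = 0

/-- `E 0, …, E d` is an ordering of the primitive idempotents of `A`, that is, they are the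
primitive idempotents for some ordering `θ 0, …, θ d` of the eigenvalues of `A`. -/
def IsPrimitiveIdempotentOrdering (A : Module.End K V) (E : Fin (d + 1) → Module.End K V) : Prop :=
  ∃ θ : Fin (d + 1) → K, Function.Injective θ ∧ Set.range θ = {μ | A.HasEigenvalue μ} ∧
    ∀ i, IsPrimitiveIdempotent A (θ i) (E i)

/-- `E i * X * E j` is zero if `|i - j| > 1` and nonzero if `|i - j| = 1`. -/
def IsIrreducibleTridiagonal (E : Fin (d + 1) → Module.End K V) (X : Module.End K V) : Prop :=
  ∀ i j : Fin (d + 1),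
    (1 < |((i : ℕ) : ℤ) - ((j : ℕ) : ℤ)| → E i * X * E j = 0) ∧
    (|((i : ℕ) : ℤ) - ((j : ℕ) : ℤ)| = 1 → E i * X * E j ≠ 0)

/-- The sequence `(A; E 0, …, E d; A*; E* 0, …, E* d)` is a Leonard system
(on a space of dimension `d + 1`). -/
structure IsLeonardSystem (A : Module.End K V) (E : Fin (d + 1) → Module.End K V)
    (Astar : Module.End K V) (Estar : Fin (d + 1) → Module.End K V) : Prop where
  multiplicityFree : IsMultiplicityFree A
  multiplicityFree_star : IsMultiplicityFree Astar
  ordering : IsPrimitiveIdempotentOrdering A E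
  ordering_star : IsPrimitiveIdempotentOrdering Astar Estar
  tridiagonal : IsIrreducibleTridiagonal Estar A
  tridiagonal_star : IsIrreducibleTridiagonal E Astar

/-- The dual map `A* = ∑ i, θ* i • E* i`. -/
def dualMap (θstar : Fin (d + 1) → K) (Estar : Fin (d + 1) → Module.End K V) : Module.End K V :=
  ∑ i, θstar i • Estar i

/-- An ordered pair `(E, F)` of primitive idempotents of `A` is `Q`-polynomial if some ordering
`G 0 = E, G 1 = F, G 2, …, G d` of the primitive idempotents of `A` is `Q`-polynomial, that is,
makes `(A; G; A*; E*)` a Leonard system. -/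
def IsQPolynomialPair (A Astar : Module.End K V) (Estar : Fin (d + 1) → Module.End K V)
    (E F : Module.End K V) : Prop :=
  ∃ G : Fin (d + 1) → Module.End K V, IsLeonardSystem A G Astar Estar ∧ G 0 = E ∧ G 1 = F

/-- Adjacency in the graph `Δ` on the vertices `0, …, d`. -/
def DeltaAdj (E : Fin (d + 1) → Module.End K V) (Astar : Module.End K V)
    (i j : Fin (d + 1)) : Prop :=
  i ≠ j ∧ E i * Astar * E j ≠ 0

/-- `(i, j)` is a tail in `Δ`: the vertex `i` is adjacent to no vertex besides `j`, and `j` is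
adjacent to at most one vertex besides `i`. -/
def IsTail (E : Fin (d + 1) → Module.End K V) (Astar : Module.End K V)
    (i j : Fin (d + 1)) : Prop :=
  (∀ k, DeltaAdj E Astar i k → k = j) ∧
  (∀ k l, DeltaAdj E Astar j k → k ≠ i → DeltaAdj E Astar j l → l ≠ i → k = l)

end LeonardTail

/-!
In a basis adapted to the idempotents `E* i` the map `A` is irreducible tridiagonal and `A*` is
diagonal; in an eigenbasis `u` of `A` adapted to the `E i`, the graph `Δ` is read off the nonzero
entries of the matrix of `A*`. The proof passes relations between `A` and `A*` from one basis to
the other.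

Suppose the `E i` admit a `Q`-polynomial ordering. The tail condition is immediate, and the `θ* i`
are distinct because a polynomial of degree `k ≤ d` in an irreducible tridiagonal matrix has a
nonzero entry `(k, 0)` (`injective_of_isLowerHessenberg`). For the recurrence, tridiagonality of `A`
gives `A*² A A* - A* A A*² = Z A - A Z` for some polynomial `Z` in `A*`. In the basis `u` the
entries `(k, 0)` of the two sides force `Z` to have degree at most `3`
(`IsLowerHessenberg.natDegree_le_three`), and comparing the coefficients of `A` in the first basis
turns this into a three-term recurrence (`exists_isRecurrent`).

Conversely, the recurrence implies a tridiagonal relation, cubic in `A*` and linear in `A`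
(`IsRecurrent.tridiagonal_relation`). If `a, b, c, x` is the only walk of length at most three in
`Δ` from `a` to `x`, the corresponding entry of the relation determines the eigenvalue at `x` from
those at `a, b, c` (`eigenvalue_eq_of_unique_walk`). Hence a path in `Δ` which starts with the tail
and whose vertices before the last one have no neighbours off the path can be continued in at most
one way. The graph is undirected (`mat_eq_zero_symm`), and the condition `θ* 0 ≠ θ* i` makes it
connected (`exists_mat_ne_zero_of_mem_of_notMem`), so the path goes on until it has visited all
vertices (`exists_path_ordering`); along it `A*` is irreducible tridiagonal, and its eigenvalues
are then distinct.
-/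

namespace LeonardTail

variable {K V : Type*} [Field K] [AddCommGroup V] [Module K V] {d : ℕ}

/-! ### Adapted bases -/

/-- The basis `b` is adapted to the family `E`: each `E i` is the projection onto the line
spanned by `b i` along the other basis vectors. -/
def IsAdapted (b : Module.Basis (Fin (d + 1)) K V) (E : Fin (d + 1) → Module.End K V) : Prop :=
  ∀ i j, E i (b j) = if i = j then b j else 0

/-- The matrix of an endomorphism with respect to `b`, as an algebra isomorphism. -/
noncomputable abbrev mat (b : Module.Basis (Fin (d + 1)) K V) :
    Module.End K V ≃ₐ[K] Matrix (Fin (d + 1)) (Fin (d + 1)) K :=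
  LinearMap.toMatrixAlgEquiv b

lemma mat_apply (b : Module.Basis (Fin (d + 1)) K V) (X : Module.End K V) (i j : Fin (d + 1)) :
    mat b X i j = b.repr (X (b j)) i :=
  LinearMap.toMatrixAlgEquiv_apply b X i j

lemma apply_basis_eq_sum (b : Module.Basis (Fin (d + 1)) K V) (X : Module.End K V)
    (j : Fin (d + 1)) : X (b j) = ∑ i, mat b X i j • b i := by
  simp only [mat_apply]
  exact (b.sum_repr _).symm

lemma mat_eq_diagonal {b : Module.Basis (Fin (d + 1)) K V} {X : Module.End K V}
    {c : Fin (d + 1) → K} (h : ∀ j, X (b j) = c j • b j) : mat b X = Matrix.diagonal c := by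
  ext i j
  rw [mat_apply, h, Matrix.diagonal_apply]
  simp only [map_smul, Module.Basis.repr_self, Finsupp.smul_apply, Finsupp.single_apply,
    smul_eq_mul]
  by_cases hij : j = i
  · subst hij; simp
  · simp [hij, Ne.symm hij]

lemma IsAdapted.apply_eq {b : Module.Basis (Fin (d + 1)) K V}
    {E : Fin (d + 1) → Module.End K V} (hb : IsAdapted b E) (i : Fin (d + 1)) (v : V) :
    E i v = b.repr v i • b i := by
  conv_lhs => rw [← b.sum_repr v, map_sum]
  simp only [map_smul, hb i, smul_ite, smul_zero, Finset.sum_ite_eq, Finset.mem_univ, if_true]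

lemma IsAdapted.mul_mul_eq_zero_iff {b : Module.Basis (Fin (d + 1)) K V}
    {E : Fin (d + 1) → Module.End K V} (hb : IsAdapted b E) (X : Module.End K V)
    (i j : Fin (d + 1)) : E i * X * E j = 0 ↔ mat b X i j = 0 := by
  constructor
  · intro h
    have h1 : (E i * X * E j) (b j) = 0 := by rw [h]; rfl
    simp only [Module.End.mul_apply, hb j j, if_true, hb.apply_eq, smul_eq_zero, b.ne_zero,
      or_false] at h1
    rwa [mat_apply]
  · intro h
    refine b.ext fun k => ?_
    rw [mat_apply] at h
    by_cases hk : j = k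
    · subst hk
      simp [Module.End.mul_apply, hb j j, hb.apply_eq, h]
    · simp [Module.End.mul_apply, hb j k, hk]

lemma dualMap_apply_basis {b : Module.Basis (Fin (d + 1)) K V}
    {E : Fin (d + 1) → Module.End K V} (hb : IsAdapted b E) (c : Fin (d + 1) → K)
    (j : Fin (d + 1)) : dualMap c E (b j) = c j • b j := by
  simp [dualMap, LinearMap.sum_apply, hb _ j]

/-- Orthogonal idempotents of rank one, as many as the dimension, have an adapted basis. -/
lemma IsOrthogonalIdempotentSystem.exists_adapted (hV : Module.finrank K V = d + 1)
    {E : Fin (d + 1) → Module.End K V} (hE : IsOrthogonalIdempotentSystem E) :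
    ∃ b : Module.Basis (Fin (d + 1)) K V, IsAdapted b E := by
  have hex : ∀ i, ∃ v : V, v ≠ 0 ∧ E i v = v := by
    intro i
    have : Nontrivial (LinearMap.range (E i)) :=
      Module.nontrivial_of_finrank_pos (R := K) (by rw [hE.rank_eq_one i]; exact one_pos)
    obtain ⟨⟨v, w, rfl⟩, hw⟩ := exists_ne (0 : LinearMap.range (E i))
    refine ⟨E i w, fun h => hw (Subtype.ext h), ?_⟩
    rw [← Module.End.mul_apply, hE.mul_eq i i, if_pos rfl]
  choose v hv0 hv using hex
  have hEv : ∀ i j, E i (v j) = if i = j then v j else 0 := by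
    intro i j
    rw [← hv j, ← Module.End.mul_apply, hE.mul_eq i j]
    split_ifs with h
    · rw [h]
    · rfl
  have hli : LinearIndependent K v := by
    rw [Fintype.linearIndependent_iff]
    intro g hg i
    have := congrArg (E i) hg
    simpa [hEv, hv0] using this
  refine ⟨basisOfLinearIndependentOfCardEqFinrank hli (by simp [hV]), fun i j => ?_⟩
  simp [hEv]

/-- A primitive idempotent system of `A` has an adapted basis, made of eigenvectors of `A`. -/
lemma exists_adapted_eigenbasis (hV : Module.finrank K V = d + 1) {A : Module.End K V}
    {θ : Fin (d + 1) → K} (hθ : Function.Injective θ) {E : Fin (d + 1) → Module.End K V}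
    (hE : ∀ i, IsPrimitiveIdempotent A (θ i) (E i)) :
    ∃ b : Module.Basis (Fin (d + 1)) K V, IsAdapted b E ∧ ∀ j, A (b j) = θ j • b j := by
  choose v hv using fun i => (hE i).hasEigenvalue.exists_hasEigenvector
  have hli : LinearIndependent K v := Module.End.eigenvectors_linearIndependent' A θ hθ v hv
  refine ⟨basisOfLinearIndependentOfCardEqFinrank hli (by simp [hV]), fun i j => ?_, fun j => ?_⟩
  · rw [coe_basisOfLinearIndependentOfCardEqFinrank]
    split_ifs with h
    · subst h; exact (hE i).apply_self _ (hv i).1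
    · exact (hE i).apply_other (θ j) (fun h' => h (hθ h').symm) _ (hv j).1
  · rw [coe_basisOfLinearIndependentOfCardEqFinrank]
    exact (hv j).apply_eq_smul

lemma repr_eq_zero_of_mem_eigenspace {b : Module.Basis (Fin (d + 1)) K V} {A : Module.End K V}
    {θ : Fin (d + 1) → K} (hA : ∀ j, A (b j) = θ j • b j) {v : V} {μ : K}
    (hv : v ∈ A.eigenspace μ) {j : Fin (d + 1)} (hj : θ j ≠ μ) : b.repr v j = 0 := by
  have h1 : A v = ∑ k, (b.repr v k * θ k) • b k := by
    conv_lhs => rw [← b.sum_repr v, map_sum]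
    simp only [map_smul, hA, smul_smul]
  have h2 := congrArg (fun w => b.repr w j) (h1.symm.trans (Module.End.mem_eigenspace_iff.1 hv))
  simp only [b.repr_sum_self, map_smul, Finsupp.smul_apply, smul_eq_mul] at h2
  have h3 : b.repr v j * (θ j - μ) = 0 := by linear_combination h2
  exact (mul_eq_zero.1 h3).resolve_right (sub_ne_zero.2 hj)

lemma hasEigenvalue_iff_of_eigenbasis {b : Module.Basis (Fin (d + 1)) K V} {A : Module.End K V}
    {θ : Fin (d + 1) → K} (hA : ∀ j, A (b j) = θ j • b j) (μ : K) :
    A.HasEigenvalue μ ↔ ∃ j, θ j = μ := by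
  constructor
  · intro h
    obtain ⟨v, hv⟩ := h.exists_hasEigenvector
    by_contra! hne
    exact hv.2 (b.repr.map_eq_zero_iff.1 (Finsupp.ext fun j =>
      repr_eq_zero_of_mem_eigenspace hA hv.1 (hne j)))
  · rintro ⟨j, rfl⟩
    exact Module.End.hasEigenvalue_of_hasEigenvector
      (x := b j) ⟨Module.End.mem_eigenspace_iff.2 (hA j), b.ne_zero j⟩

/-- Members of an adapted eigenbasis with distinct eigenvalues project onto the eigenspaces. -/
lemma IsAdapted.isPrimitiveIdempotent {b : Module.Basis (Fin (d + 1)) K V} {A : Module.End K V}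
    {θ : Fin (d + 1) → K} (hA : ∀ j, A (b j) = θ j • b j) (hθ : Function.Injective θ)
    {E : Fin (d + 1) → Module.End K V} (hb : IsAdapted b E) (i : Fin (d + 1)) :
    IsPrimitiveIdempotent A (θ i) (E i) := by
  refine ⟨(hasEigenvalue_iff_of_eigenbasis hA _).2 ⟨i, rfl⟩, fun v hv => ?_, fun μ hμ v hv => ?_⟩
  · rw [hb.apply_eq]
    conv_rhs => rw [← b.sum_repr v]
    symm
    refine Finset.sum_eq_single i (fun j _ hj => ?_) (by simp)
    rw [repr_eq_zero_of_mem_eigenspace hA hv (fun h => hj (hθ h)), zero_smul]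
  · rw [hb.apply_eq, repr_eq_zero_of_mem_eigenspace hA hv hμ.symm, zero_smul]

/-! ### Tridiagonal matrices -/

/-- The matrix `N` vanishes below the subdiagonal and has no zero on the subdiagonal. -/
def IsLowerHessenberg (N : Matrix (Fin (d + 1)) (Fin (d + 1)) K) : Prop :=
  (∀ i j : Fin (d + 1), (j : ℕ) + 1 < i → N i j = 0) ∧
  ∀ i j : Fin (d + 1), (i : ℕ) = j + 1 → N i j ≠ 0

/-- Irreducible tridiagonality, stated for the entries of a matrix. -/
def IsTridiag (M : Matrix (Fin (d + 1)) (Fin (d + 1)) K) : Prop :=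
  ∀ i j : Fin (d + 1),
      (1 < |((i : ℕ) : ℤ) - ((j : ℕ) : ℤ)| → M i j = 0) ∧
      (|((i : ℕ) : ℤ) - ((j : ℕ) : ℤ)| = 1 → M i j ≠ 0)

lemma IsTridiag.eq_zero {M : Matrix (Fin (d + 1)) (Fin (d + 1)) K} (hM : IsTridiag M)
    {i j : Fin (d + 1)} (h : (i : ℕ) + 1 < j ∨ (j : ℕ) + 1 < i) : M i j = 0 := by
  refine (hM i j).1 ?_
  rw [lt_abs]
  omega

lemma IsTridiag.ne_zero {M : Matrix (Fin (d + 1)) (Fin (d + 1)) K} (hM : IsTridiag M)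
    {i j : Fin (d + 1)} (h : (i : ℕ) + 1 = j ∨ (j : ℕ) + 1 = i) : M i j ≠ 0 := by
  refine (hM i j).2 ?_
  rw [abs_eq one_pos.le]
  omega

lemma IsTridiag.isLowerHessenberg {M : Matrix (Fin (d + 1)) (Fin (d + 1)) K} (hM : IsTridiag M) :
    IsLowerHessenberg M :=
  ⟨fun _ _ h => hM.eq_zero (Or.inr h), fun _ _ h => hM.ne_zero (Or.inr h.symm)⟩

/-- Entrywise factors of a tridiagonal matrix matter only on the diagonal and next to it. -/
lemma IsTridiag.mul_eq_mul {M : Matrix (Fin (d + 1)) (Fin (d + 1)) K} (hM : IsTridiag M)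
    {f g : Fin (d + 1) → Fin (d + 1) → K} (hdiag : ∀ i, f i i = g i i)
    (hup : ∀ i j : Fin (d + 1), (i : ℕ) + 1 = j → f i j = g i j ∧ f j i = g j i)
    (i j : Fin (d + 1)) : f i j * M i j = g i j * M i j := by
  rcases lt_trichotomy (i : ℕ) j with h | h | h
  · rcases (Nat.succ_le_of_lt h).eq_or_lt with h' | h'
    · rw [(hup i j h').1]
    · rw [hM.eq_zero (Or.inl h'), mul_zero, mul_zero]
  · obtain rfl := Fin.ext h
    rw [hdiag]
  · rcases (Nat.succ_le_of_lt h).eq_or_lt with h' | h'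
    · rw [(hup j i h').2]
    · rw [hM.eq_zero (Or.inr h'), mul_zero, mul_zero]

lemma IsAdapted.tridiagonal_iff {b : Module.Basis (Fin (d + 1)) K V}
    {E : Fin (d + 1) → Module.End K V} (hb : IsAdapted b E) (X : Module.End K V) :
    IsIrreducibleTridiagonal E X ↔ IsTridiag (mat b X) := by
  simp only [IsIrreducibleTridiagonal, IsTridiag, ne_eq, hb.mul_mul_eq_zero_iff]

open Polynomial in
lemma aeval_apply_basis {b : Module.Basis (Fin (d + 1)) K V} {X : Module.End K V}
    {c : Fin (d + 1) → K} (h : ∀ j, X (b j) = c j • b j) (p : K[X]) (j : Fin (d + 1)) :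
    aeval X p (b j) = p.eval (c j) • b j :=
  Module.End.aeval_apply_of_hasEigenvector
    ⟨Module.End.mem_eigenspace_iff.2 (h j), b.ne_zero j⟩

lemma IsLowerHessenberg.mul_apply_eq_zero {N : Matrix (Fin (d + 1)) (Fin (d + 1)) K}
    (hN : IsLowerHessenberg N) {X : Matrix (Fin (d + 1)) (Fin (d + 1)) K} {m : ℕ}
    (hX : ∀ i : Fin (d + 1), m < i → X i 0 = 0) (i : Fin (d + 1)) (hi : m + 1 < i) :
    (N * X) i 0 = 0 := by
  rw [Matrix.mul_apply]
  refine Finset.sum_eq_zero fun j _ => ?_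
  by_cases hj : m < j
  · rw [hX j hj, mul_zero]
  · rw [hN.1 i j (by omega), zero_mul]

/-- The first column of `N ^ m` reaches exactly down to row `m`. -/
lemma IsLowerHessenberg.pow_apply {N : Matrix (Fin (d + 1)) (Fin (d + 1)) K}
    (hN : IsLowerHessenberg N) (m : ℕ) :
    (∀ i : Fin (d + 1), m < i → (N ^ m) i 0 = 0) ∧
      ∀ i : Fin (d + 1), (i : ℕ) = m → (N ^ m) i 0 ≠ 0 := by
  induction m with
  | zero =>
    refine ⟨fun i hi => ?_, fun i hi => ?_⟩
    · rw [pow_zero, Matrix.one_apply_ne]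
      rintro rfl
      simp at hi
    · obtain rfl : i = 0 := Fin.ext hi
      simp
  | succ m ih =>
    rw [pow_succ']
    refine ⟨fun i hi => hN.mul_apply_eq_zero ih.1 i hi, fun i hi => ?_⟩
    have hm : m < d + 1 := by omega
    rw [Matrix.mul_apply, Finset.sum_eq_single ⟨m, hm⟩]
    · exact mul_ne_zero (hN.2 _ _ hi) (ih.2 _ rfl)
    · intro j _ hj
      have hj' : (j : ℕ) ≠ m := fun h => hj (Fin.ext h)
      by_cases h : m < j
      · rw [ih.1 j h, mul_zero]
      · rw [hN.1 i j (by omega), zero_mul]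
    · simp

open Polynomial in
/-- A polynomial of degree `k ≤ d` in a lower Hessenberg matrix has a nonzero entry `(k, 0)`. -/
lemma IsLowerHessenberg.aeval_apply_ne_zero {N : Matrix (Fin (d + 1)) (Fin (d + 1)) K}
    (hN : IsLowerHessenberg N) {p : K[X]} (hp : p ≠ 0) (k : Fin (d + 1))
    (hk : p.natDegree = k) : (aeval N p) k 0 ≠ 0 := by
  rw [aeval_eq_sum_range, Finset.sum_range_succ, Matrix.add_apply, Matrix.sum_apply,
    Finset.sum_eq_zero, zero_add, Matrix.smul_apply, smul_eq_mul]
  · exact mul_ne_zero (leadingCoeff_ne_zero.2 hp) ((hN.pow_apply _).2 k hk.symm)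
  · intro m hm
    rw [Matrix.smul_apply, (hN.pow_apply m).1 k (by rw [← hk]; exact Finset.mem_range.1 hm),
      smul_zero]

open Polynomial in
/-- A diagonalizable map with an irreducible tridiagonal matrix is multiplicity-free: otherwise
a nonzero polynomial of degree at most `d` would annihilate it. -/
lemma injective_of_isLowerHessenberg {b u : Module.Basis (Fin (d + 1)) K V} {Y : Module.End K V}
    {c : Fin (d + 1) → K} (h : ∀ j, Y (b j) = c j • b j) (hN : IsLowerHessenberg (mat u Y)) :
    Function.Injective c := by
  classical
  by_contra hc
  -- The product of `X - C x` over the distinct values `x` of `c` annihilates `Y`.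
  set S := Finset.univ.image c
  have hS : S.card < d + 1 := by
    refine lt_of_le_of_ne (Finset.card_image_le.trans (by simp)) fun hS => hc ?_
    have : S.card = (Finset.univ : Finset (Fin (d + 1))).card := by rw [hS]; simp
    simpa using Finset.card_image_iff.1 this
  have hdeg : (∏ x ∈ S, (X - C x : K[X])).natDegree = S.card := by
    exact natDegree_finsetProd_X_sub_C_eq_card S (fun x => x)
  have h0 : aeval Y (∏ x ∈ S, (X - C x : K[X])) = 0 := by
    refine b.ext fun j => ?_
    rw [aeval_apply_basis h, eval_prod, Finset.prod_eq_zero (i := c j), zero_smul,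
      LinearMap.zero_apply]
    · exact Finset.mem_image_of_mem _ (Finset.mem_univ j)
    · simp
  refine hN.aeval_apply_ne_zero (monic_prod_X_sub_C (fun x => x) S).ne_zero ⟨S.card, hS⟩ hdeg ?_
  rw [Polynomial.aeval_algHom_apply, h0, map_zero, Matrix.zero_apply]

open Polynomial in
/-- The degree bound behind the three-term recurrence: `N² T N - N T N²` is of degree at most `3`
in the lower Hessenberg matrix `N`, while `p(N) T - T p(N)` has the full degree of `p`. -/
lemma IsLowerHessenberg.natDegree_le_three {N : Matrix (Fin (d + 1)) (Fin (d + 1)) K}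
    (hN : IsLowerHessenberg N) {θ : Fin (d + 1) → K} (hθ : Function.Injective θ) {p : K[X]}
    (hp : p.natDegree ≤ d)
    (h : N * (N * (Matrix.diagonal θ * N)) - N * (Matrix.diagonal θ * (N * N)) =
      aeval N p * Matrix.diagonal θ - Matrix.diagonal θ * aeval N p) : p.natDegree ≤ 3 := by
  by_contra! h3
  have hp0 : p ≠ 0 := by rintro rfl; simp at h3
  set k : Fin (d + 1) := ⟨p.natDegree, by omega⟩ with hk
  have h1 : ∀ i : Fin (d + 1), 1 < (i : ℕ) → N i 0 = 0 := by
    simpa using (hN.pow_apply 1).1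
  have hdiag : ∀ (X : Matrix (Fin (d + 1)) (Fin (d + 1)) K) (m : ℕ),
      (∀ i : Fin (d + 1), m < i → X i 0 = 0) →
        ∀ i : Fin (d + 1), m < i → (Matrix.diagonal θ * X) i 0 = 0 := by
    intro X m hX i hi
    rw [Matrix.diagonal_mul, hX i hi, mul_zero]
  have hL1 := hN.mul_apply_eq_zero (hN.mul_apply_eq_zero (hdiag _ _ h1)) k (by simpa [hk] using h3)
  have hL2 := hN.mul_apply_eq_zero (hdiag _ _ (hN.mul_apply_eq_zero h1)) k (by simpa [hk] using h3)
  have hk0 := congrFun (congrFun h k) 0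
  rw [Matrix.sub_apply, hL1, hL2, Matrix.sub_apply, Matrix.mul_diagonal, Matrix.diagonal_mul] at hk0
  have h4 : (aeval N p) k 0 * (θ 0 - θ k) = 0 := by linear_combination -hk0
  rcases mul_eq_zero.1 h4 with h5 | h5
  · exact hN.aeval_apply_ne_zero hp0 k rfl h5
  · have := congrArg Fin.val (hθ (sub_eq_zero.1 h5))
    simp [hk] at this
    omega

/-! ### Symmetry of the graph -/

/-- An irreducible tridiagonal matrix is symmetrized by an invertible diagonal matrix. -/
lemma IsTridiag.exists_symmetrizer {M : Matrix (Fin (d + 1)) (Fin (d + 1)) K}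
    (hM : IsTridiag M) : ∃ δ : Fin (d + 1) → K, (∀ i, δ i ≠ 0) ∧
      SemiconjBy (Matrix.diagonal δ) M.transpose M := by
  -- The ratio of consecutive diagonal entries is forced by the entries next to the diagonal.
  set r : ℕ → K := fun h => if hh : h + 1 < d + 1 then
    M ⟨h + 1, hh⟩ ⟨h, by omega⟩ / M ⟨h, by omega⟩ ⟨h + 1, hh⟩ else 1 with hr
  have hr0 : ∀ h, r h ≠ 0 := by
    intro h
    simp only [hr]
    split_ifs with hh
    · exact div_ne_zero (hM.ne_zero (Or.inr rfl)) (hM.ne_zero (Or.inl rfl))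
    · exact one_ne_zero
  have hδ0 : ∀ n, (∏ h ∈ Finset.range n, r h) ≠ 0 :=
    fun n => Finset.prod_ne_zero_iff.2 fun h _ => hr0 h
  have hstep : ∀ i j : Fin (d + 1), (i : ℕ) + 1 = j →
      (∏ h ∈ Finset.range i, r h) * M j i = M i j * ∏ h ∈ Finset.range j, r h := by
    intro i j hij
    obtain ⟨j, hj⟩ := j
    obtain rfl : (i : ℕ) + 1 = j := hij
    have hne : M i ⟨(i : ℕ) + 1, hj⟩ ≠ 0 := hM.ne_zero (Or.inl rfl)
    have hri : r i = M ⟨(i : ℕ) + 1, hj⟩ i / M i ⟨(i : ℕ) + 1, hj⟩ := by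
      simp only [hr]
      rw [dif_pos hj]
    rw [Finset.prod_range_succ, hri]
    field_simp
  refine ⟨fun i => ∏ h ∈ Finset.range i, r h, fun i => hδ0 i, ?_⟩
  ext i j
  rw [Matrix.diagonal_mul, Matrix.mul_diagonal, Matrix.transpose_apply]
  rcases lt_trichotomy (i : ℕ) j with h | h | h
  · rcases (Nat.succ_le_of_lt h).eq_or_lt with h' | h'
    · exact hstep i j h'
    · rw [hM.eq_zero (Or.inl h'), hM.eq_zero (Or.inr h'), mul_zero, zero_mul]
  · obtain rfl := Fin.ext h
    exact mul_comm _ _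
  · rcases (Nat.succ_le_of_lt h).eq_or_lt with h' | h'
    · rw [mul_comm, ← hstep j i h', mul_comm]
    · rw [hM.eq_zero (Or.inl h'), hM.eq_zero (Or.inr h'), mul_zero, zero_mul]

open Polynomial in
lemma semiconjBy_aeval_transpose {D M : Matrix (Fin (d + 1)) (Fin (d + 1)) K}
    (h : SemiconjBy D M.transpose M) (p : K[X]) :
    SemiconjBy D (aeval M p).transpose (aeval M p) := by
  induction p using Polynomial.induction_on' with
  | add p q hp hq =>
    rw [map_add, Matrix.transpose_add]
    exact hp.add_right hq
  | monomial n a =>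
    rw [aeval_monomial, ← Algebra.smul_def, Matrix.transpose_smul, Matrix.transpose_pow]
    have := h.pow_right n
    rw [SemiconjBy, mul_smul_comm, smul_mul_assoc, this.eq]

open Polynomial in
/-- Primitive idempotents of `A` are polynomials in `A`. -/
lemma IsAdapted.eq_aeval {u : Module.Basis (Fin (d + 1)) K V} {A : Module.End K V}
    {θ : Fin (d + 1) → K} (hA : ∀ j, A (u j) = θ j • u j) (hθ : Function.Injective θ)
    {E : Fin (d + 1) → Module.End K V} (hu : IsAdapted u E) (i : Fin (d + 1)) :
    E i = aeval A (Lagrange.basis Finset.univ θ i) := by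
  refine u.ext fun j => ?_
  rw [aeval_apply_basis hA, hu i j]
  split_ifs with h
  · subst h
    rw [Lagrange.eval_basis_self hθ.injOn (Finset.mem_univ _), one_smul]
  · rw [Lagrange.eval_basis_of_ne h (Finset.mem_univ _), zero_smul]

/-- Adjacency in `Δ` is symmetric: in a basis where `A` is tridiagonal and `A*` diagonal, a
diagonal change of basis followed by transposition fixes `A` and `A*`, hence also the `E i`. -/
lemma mat_eq_zero_symm {b u : Module.Basis (Fin (d + 1)) K V} {A Astar : Module.End K V}
    {t θ : Fin (d + 1) → K} (hAs : ∀ j, Astar (b j) = t j • b j) (hM : IsTridiag (mat b A))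
    (hA : ∀ j, A (u j) = θ j • u j) (hθ : Function.Injective θ)
    {E : Fin (d + 1) → Module.End K V} (hu : IsAdapted u E) {i j : Fin (d + 1)}
    (h : mat u Astar i j = 0) : mat u Astar j i = 0 := by
  obtain ⟨δ, hδ, hD⟩ := hM.exists_symmetrizer
  rw [← hu.mul_mul_eq_zero_iff] at h ⊢
  have hE : ∀ k, SemiconjBy (Matrix.diagonal δ) (mat b (E k)).transpose (mat b (E k)) := by
    intro k
    rw [hu.eq_aeval hA hθ k, ← Polynomial.aeval_algHom_apply]
    exact semiconjBy_aeval_transpose hD _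
  have hL : SemiconjBy (Matrix.diagonal δ) (mat b Astar).transpose (mat b Astar) := by
    rw [mat_eq_diagonal hAs, Matrix.diagonal_transpose]
    exact Matrix.commute_diagonal _ _
  have h1 := (((hE j).mul_right hL).mul_right (hE i)).eq
  rw [← Matrix.transpose_mul, ← Matrix.transpose_mul] at h1
  apply (mat b).injective
  have h2 : mat b (E i) * mat b Astar * mat b (E j) = 0 := by rw [← map_mul, ← map_mul, h, map_zero]
  rw [← mul_assoc, h2, Matrix.transpose_zero, mul_zero] at h1
  rw [map_mul, map_mul, map_zero]
  ext k l
  have h3 := congrFun (congrFun h1 k) l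
  rw [Matrix.mul_diagonal, Matrix.zero_apply] at h3
  exact (mul_eq_zero.1 h3.symm).resolve_right (hδ l)

/-! ### Connectedness of the graph -/

/-- The first basis vector generates the space under an irreducible tridiagonal map. -/
lemma IsLowerHessenberg.eq_top {b : Module.Basis (Fin (d + 1)) K V} {A : Module.End K V}
    (hM : IsLowerHessenberg (mat b A)) {W : Submodule K V} (hW : ∀ v ∈ W, A v ∈ W)
    (h0 : b 0 ∈ W) : W = ⊤ := by
  have key : ∀ n (hn : n < d + 1), b ⟨n, hn⟩ ∈ W := by
    intro n
    induction n using Nat.strong_induction_on with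
    | _ n ih =>
      intro hn
      rcases n with _ | n
      · exact h0
      have hn' : n < d + 1 := by omega
      have h1 := hW _ (ih n (by omega) hn')
      rw [apply_basis_eq_sum, ← Finset.add_sum_erase _ _ (Finset.mem_univ ⟨n + 1, hn⟩)] at h1
      have h2 : ∑ i ∈ Finset.univ.erase ⟨n + 1, hn⟩, mat b A i ⟨n, hn'⟩ • b i ∈ W := by
        refine W.sum_mem fun i hi => ?_
        have hne : (i : ℕ) ≠ n + 1 := fun h => Finset.ne_of_mem_erase hi (Fin.ext h)
        by_cases h : n + 1 < i
        · rw [hM.1 i _ h, zero_smul]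
          exact W.zero_mem
        · exact W.smul_mem _ (ih i (by omega) i.2)
      exact (W.smul_mem_iff (hM.2 _ _ rfl)).1 ((W.add_mem_iff_left h2).1 h1)
  rw [eq_top_iff, ← b.span_eq, Submodule.span_le]
  rintro _ ⟨i, rfl⟩
  exact key i i.2

/-- The graph `Δ` is connected: the projection onto a union of components commutes with `A` and
`A*`, hence preserves the line of `b 0`, hence is a scalar. -/
lemma exists_mat_ne_zero_of_mem_of_notMem {b u : Module.Basis (Fin (d + 1)) K V}
    {A Astar : Module.End K V} {t θ : Fin (d + 1) → K} (hAs : ∀ j, Astar (b j) = t j • b j)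
    (ht : ∀ h, h ≠ 0 → t 0 ≠ t h) (hM : IsTridiag (mat b A)) (hA : ∀ j, A (u j) = θ j • u j)
    (hsymm : ∀ i j, mat u Astar i j = 0 → mat u Astar j i = 0) {S : Set (Fin (d + 1))}
    {x y : Fin (d + 1)} (hx : x ∈ S) (hy : y ∉ S) :
    ∃ i ∈ S, ∃ j ∉ S, mat u Astar i j ≠ 0 := by
  classical
  by_contra! hS
  set χ : Fin (d + 1) → K := fun i => if i ∈ S then 1 else 0 with hχ
  set e : Module.End K V := (mat u).symm (Matrix.diagonal χ) with he
  have hme : mat u e = Matrix.diagonal χ := by rw [he, AlgEquiv.apply_symm_apply]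
  have heu : ∀ j, e (u j) = χ j • u j := by
    intro j
    rw [apply_basis_eq_sum, hme]
    simp [Matrix.diagonal_apply]
  have heA : e * A = A * e := by
    refine u.ext fun j => ?_
    rw [Module.End.mul_apply, Module.End.mul_apply, hA, heu, map_smul, map_smul, hA, heu, smul_comm]
  have heAs : e * Astar = Astar * e := by
    apply (mat u).injective
    ext i j
    rw [map_mul, map_mul, hme, Matrix.diagonal_mul, Matrix.mul_diagonal]
    by_cases hi : i ∈ S <;> by_cases hj : j ∈ S
    · simp [hχ, hi, hj]
    · simp [hS i hi j hj]
    · simp [hsymm j i (hS j hj i hi)]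
    · simp [hχ, hi, hj]
  obtain ⟨c, hc⟩ : ∃ c : K, e (b 0) = c • b 0 := by
    refine ⟨mat b e 0 0, ?_⟩
    rw [apply_basis_eq_sum]
    refine Finset.sum_eq_single 0 (fun i _ hi => ?_) (by simp)
    have h1 := congrFun (congrFun (congrArg (mat b) heAs) i) 0
    rw [map_mul, map_mul, mat_eq_diagonal hAs, Matrix.diagonal_mul, Matrix.mul_diagonal] at h1
    have h2 : mat b e i 0 * (t 0 - t i) = 0 := by linear_combination h1
    rw [(mul_eq_zero.1 h2).resolve_right (sub_ne_zero.2 (ht i hi)), zero_smul]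
  have htop : LinearMap.ker (e - algebraMap K (Module.End K V) c) = ⊤ := by
    refine hM.isLowerHessenberg.eq_top (fun v hv => ?_) (by simp [hc])
    rw [LinearMap.mem_ker, LinearMap.sub_apply, Module.algebraMap_end_apply, sub_eq_zero] at hv ⊢
    rw [← Module.End.mul_apply, heA, Module.End.mul_apply, hv, map_smul]
  have hec : ∀ j, χ j = c := by
    intro j
    have h1 : u j ∈ LinearMap.ker (e - algebraMap K (Module.End K V) c) := by rw [htop]; trivial
    rw [LinearMap.mem_ker, LinearMap.sub_apply, Module.algebraMap_end_apply, heu, ← sub_smul] at h1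
    exact sub_eq_zero.1 ((smul_eq_zero.1 h1).resolve_right (u.ne_zero j))
  have h1 := (hec x).trans (hec y).symm
  simp [hχ, hx, hy] at h1

/-! ### The recurrence for the dual eigenvalues -/

/-- The dual eigenvalues satisfy a three-term recurrence with constant right-hand side. -/
def IsRecurrent (t : Fin (d + 1) → K) (β γ : K) : Prop :=
  ∀ (h : ℕ) (_ : 1 ≤ h) (_ : h ≤ d - 1),
    t ⟨h - 1, by omega⟩ - β * t ⟨h, by omega⟩ + t ⟨h + 1, by omega⟩ = γ

/-- The hypothesis is `p(x) - p(y) = x y (x - y)` for a cubic `p`, divided by `x - y`; subtracting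
two consecutive instances and dividing by `t (i - 1) - t (i + 1)` makes it linear. -/
lemma exists_isRecurrent_of_cubic {t : Fin (d + 1) → K} (ht : Function.Injective t) (a b c : K)
    (h : ∀ i j : Fin (d + 1), (i : ℕ) + 1 = j →
      t i * t j = a * (t i ^ 2 + t i * t j + t j ^ 2) + b * (t i + t j) + c) :
    ∃ β γ : K, IsRecurrent t β γ := by
  have h3 : ∀ (h : ℕ) (_ : 1 ≤ h) (_ : h ≤ d - 1),
      t ⟨h, by omega⟩ = a * (t ⟨h - 1, by omega⟩ + t ⟨h, by omega⟩ + t ⟨h + 1, by omega⟩) + b := by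
    intro k hk1 hk2
    have e1 := h ⟨k - 1, by omega⟩ ⟨k, by omega⟩ (by simp; omega)
    have e2 := h ⟨k, by omega⟩ ⟨k + 1, by omega⟩ rfl
    have hne : t ⟨k - 1, by omega⟩ - t ⟨k + 1, by omega⟩ ≠ 0 := by
      refine sub_ne_zero.2 fun hh => ?_
      have := congrArg Fin.val (ht hh)
      simp at this
    apply mul_left_cancel₀ hne
    linear_combination e1 - e2
  by_cases ha : a = 0
  · -- Here all inner dual eigenvalues equal `b`, so there is at most one of them.
    refine ⟨0, t ⟨0, by omega⟩ + t (Fin.ofNat (d + 1) 2), fun k hk1 hk2 => ?_⟩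
    have e1 := h3 k hk1 hk2
    have e2 := h3 1 le_rfl (by omega)
    rw [ha, zero_mul, zero_add] at e1 e2
    have hk : k = 1 := congrArg Fin.val (ht (e1.trans e2.symm))
    subst hk
    have h2 : Fin.ofNat (d + 1) 2 = ⟨1 + 1, by omega⟩ :=
      Fin.ext (Nat.mod_eq_of_lt (by omega))
    rw [h2]
    simp
  · refine ⟨1 / a - 1, -b / a, fun k hk1 hk2 => ?_⟩
    have e1 := h3 k hk1 hk2
    field_simp
    linear_combination -e1

open Polynomial in
/-- For a Leonard system the dual eigenvalues are recurrent: `A*² A A* - A* A A*²` is a commutator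
`Z A - A Z` with `Z` a polynomial in `A*`, of degree at most `3` by comparing both sides in an
eigenbasis of `A`. -/
lemma exists_isRecurrent {b u : Module.Basis (Fin (d + 1)) K V} {A Astar : Module.End K V}
    {t θ : Fin (d + 1) → K} (hAs : ∀ j, Astar (b j) = t j • b j) (hM : IsTridiag (mat b A))
    (hA : ∀ j, A (u j) = θ j • u j) (hθ : Function.Injective θ)
    (hN : IsLowerHessenberg (mat u Astar)) : ∃ β γ : K, IsRecurrent t β γ := by
  have ht := injective_of_isLowerHessenberg hAs hN
  set s : ℕ → K := fun n => if hn : n < d + 1 then t ⟨n, hn⟩ else 0 with hs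
  have hst : ∀ i : Fin (d + 1), s i = t i := fun i => dif_pos i.2
  -- `z i` is to be the eigenvalue of `Z` on `b i`: only differences of neighbours are prescribed.
  set z : Fin (d + 1) → K := fun i => -∑ h ∈ Finset.range i, s h * s (h + 1) * (s h - s (h + 1))
    with hz
  have hzz : ∀ i j : Fin (d + 1), (i : ℕ) + 1 = j → z i - z j = t i * t j * (t i - t j) := by
    intro i j hij
    simp only [hz]
    rw [← hij, Finset.sum_range_succ, hij, hst, hst]
    ring
  set p := Lagrange.interpolate Finset.univ t z with hp
  have hpt : ∀ i, p.eval (t i) = z i := fun i =>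
    Lagrange.eval_interpolate_at_node z ht.injOn (Finset.mem_univ i)
  have hdeg : p.natDegree ≤ d := by
    have h1 : p.degree < ((d + 1 : ℕ) : WithBot ℕ) := by
      have h2 := Lagrange.degree_interpolate_lt (s := Finset.univ) z ht.injOn
      rwa [Finset.card_univ, Fintype.card_fin] at h2
    exact natDegree_le_iff_coeff_eq_zero.2 fun N hN =>
      coeff_eq_zero_of_degree_lt (h1.trans_le (Nat.cast_le.2 hN))
  have hrel : Astar * (Astar * (A * Astar)) - Astar * (A * (Astar * Astar)) =
      aeval Astar p * A - A * aeval Astar p := by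
    apply (mat b).injective
    have hZ : mat b (aeval Astar p) = Matrix.diagonal z :=
      mat_eq_diagonal fun j => by rw [aeval_apply_basis hAs, hpt]
    simp only [map_sub, map_mul, hZ, mat_eq_diagonal hAs]
    ext i j
    simp only [Matrix.sub_apply, Matrix.diagonal_mul, Matrix.mul_diagonal,
      Matrix.diagonal_mul_diagonal]
    have := hM.mul_eq_mul (f := fun i j => t i * t i * t j - t i * (t j * t j))
      (g := fun i j => z i - z j) (fun i => by ring) (fun i j hij => by
        constructor
        · linear_combination -hzz i j hij
        · linear_combination hzz i j hij) i j
    linear_combination this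
  have hrel2 := congrArg (mat u) hrel
  simp only [map_sub, map_mul, mat_eq_diagonal hA] at hrel2
  rw [← Polynomial.aeval_algHom_apply] at hrel2
  have h3 := hN.natDegree_le_three hθ hdeg hrel2
  have hev : ∀ x : K, p.eval x = p.coeff 0 + p.coeff 1 * x + p.coeff 2 * x ^ 2 +
      p.coeff 3 * x ^ 3 := by
    intro x
    rw [eval_eq_sum_range' (n := 4) (by omega)]
    simp [Finset.sum_range_succ]
  refine exists_isRecurrent_of_cubic ht (p.coeff 3) (p.coeff 2) (p.coeff 1) fun i j hij => ?_
  have hne : t i - t j ≠ 0 := by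
    refine sub_ne_zero.2 fun hh => ?_
    have := congrArg Fin.val (ht hh)
    omega
  have e := hzz i j hij
  rw [← hpt, ← hpt, hev, hev] at e
  apply mul_left_cancel₀ hne
  linear_combination -e

/-- The recurrence integrates to a quadratic invariant of consecutive terms: the values at
`(x, y)` and `(y, z)` differ by `(x - z) (x - β y + z - γ)`. -/
lemma IsRecurrent.exists_invariant {t : Fin (d + 1) → K} {β γ : K} (h : IsRecurrent t β γ) :
    ∃ ρ : K, ∀ i j : Fin (d + 1), (i : ℕ) + 1 = j →
      t i ^ 2 - β * t i * t j + t j ^ 2 - γ * (t i + t j) = ρ := by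
  set f : Fin (d + 1) → Fin (d + 1) → K := fun i j =>
    t i ^ 2 - β * t i * t j + t j ^ 2 - γ * (t i + t j) with hf
  refine ⟨f 0 (Fin.ofNat (d + 1) 1), ?_⟩
  have key : ∀ n (hn : n + 1 < d + 1), f ⟨n, by omega⟩ ⟨n + 1, hn⟩ = f 0 (Fin.ofNat (d + 1) 1) := by
    intro n
    induction n with
    | zero =>
      intro hn
      have h1 : Fin.ofNat (d + 1) 1 = ⟨0 + 1, hn⟩ := Fin.ext (Nat.mod_eq_of_lt hn)
      rw [h1]
      rfl
    | succ n ih =>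
      intro hn
      rw [← ih (by omega)]
      have e := h (n + 1) (by omega) (by omega)
      simp only [Nat.add_sub_cancel] at e
      simp only [hf]
      linear_combination (t ⟨n + 1 + 1, hn⟩ - t ⟨n, by omega⟩) * e
  intro i j hij
  obtain ⟨j, hj⟩ := j
  obtain rfl : (i : ℕ) + 1 = j := hij
  exact key i hj

/-- The tridiagonal relation, written out so that it can be read entrywise in an eigenbasis
of `A`. -/
lemma IsRecurrent.tridiagonal_relation {b : Module.Basis (Fin (d + 1)) K V}
    {A Astar : Module.End K V} {t : Fin (d + 1) → K} (hAs : ∀ j, Astar (b j) = t j • b j)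
    (hM : IsTridiag (mat b A)) {β γ : K} (h : IsRecurrent t β γ) : ∃ ρ : K,
      Astar * (Astar * (Astar * A)) - (β + 1) • (Astar * (Astar * (A * Astar))) +
        (β + 1) • (Astar * (A * (Astar * Astar))) - A * (Astar * (Astar * Astar)) =
      γ • (Astar * (Astar * A) - A * (Astar * Astar)) + ρ • (Astar * A - A * Astar) := by
  obtain ⟨ρ, hρ⟩ := h.exists_invariant
  refine ⟨ρ, (mat b).injective ?_⟩
  simp only [map_sub, map_add, map_mul, map_smul, mat_eq_diagonal hAs]
  ext i j
  simp only [Matrix.sub_apply, Matrix.add_apply, Matrix.smul_apply, Matrix.diagonal_mul,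
    Matrix.mul_diagonal, Matrix.diagonal_mul_diagonal, smul_eq_mul]
  have := hM.mul_eq_mul
    (f := fun i j => (t i - t j) * (t i ^ 2 - β * t i * t j + t j ^ 2 - γ * (t i + t j)))
    (g := fun i j => (t i - t j) * ρ) (fun i => by ring) (fun i j hij => by
      constructor
      · linear_combination (t i - t j) * hρ i j hij
      · linear_combination (t j - t i) * hρ i j hij) i j
  linear_combination this

/-! ### Extending a path in the graph -/

/-- If `a, b, c, x` is the only walk of length at most three from `a` to `x` (where steps may
also stand still), the tridiagonal relation determines the eigenvalue at `x`. -/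
lemma eigenvalue_eq_of_unique_walk {N : Matrix (Fin (d + 1)) (Fin (d + 1)) K}
    {θ : Fin (d + 1) → K} {β γ ρ : K}
    (hrel : N * (N * (N * Matrix.diagonal θ)) - (β + 1) • (N * (N * (Matrix.diagonal θ * N))) +
        (β + 1) • (N * (Matrix.diagonal θ * (N * N))) - Matrix.diagonal θ * (N * (N * N)) =
      γ • (N * (N * Matrix.diagonal θ) - Matrix.diagonal θ * (N * N)) +
        ρ • (N * Matrix.diagonal θ - Matrix.diagonal θ * N))
    {a b c x : Fin (d + 1)} (hbc : b ≠ c) (hab : N a b ≠ 0) (hbc' : N b c ≠ 0) (hcx : N c x ≠ 0)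
    (huniq : ∀ k l, a = k ∨ N a k ≠ 0 → k = l ∨ N k l ≠ 0 → l = x ∨ N l x ≠ 0 → k = b ∧ l = c) :
    θ x = (β + 1) * θ c - (β + 1) * θ b + θ a := by
  have hax : N a x = 0 := by
    by_contra h
    obtain ⟨h1, h2⟩ := huniq a a (Or.inl rfl) (Or.inl rfl) (Or.inr h)
    exact hbc (h1.symm.trans h2)
  have htwo : (N * N) a x = 0 := by
    rw [Matrix.mul_apply]
    refine Finset.sum_eq_zero fun k _ => ?_
    by_contra h
    obtain ⟨h1, h2⟩ := huniq k k (Or.inr (left_ne_zero_of_mul h)) (Or.inl rfl)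
      (Or.inr (right_ne_zero_of_mul h))
    exact hbc (h1.symm.trans h2)
  have hthree : ∀ w w' : Fin (d + 1) → K,
      (N * (Matrix.diagonal w * (N * (Matrix.diagonal w' * N)))) a x =
        N a b * (w b * (N b c * (w' c * N c x))) := by
    intro w w'
    rw [Matrix.mul_apply, Finset.sum_eq_single b, Matrix.diagonal_mul, Matrix.mul_apply,
      Finset.sum_eq_single c, Matrix.diagonal_mul]
    · intro l _ hl
      rw [Matrix.diagonal_mul]
      by_contra h
      exact hl (huniq b l (Or.inr hab) (Or.inr (left_ne_zero_of_mul h))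
        (Or.inr (right_ne_zero_of_mul (right_ne_zero_of_mul h)))).2
    · simp
    · intro k _ hk
      by_cases hak : N a k = 0
      · rw [hak, zero_mul]
      rw [Matrix.diagonal_mul, Matrix.mul_apply, Finset.sum_eq_zero, mul_zero, mul_zero]
      intro l _
      rw [Matrix.diagonal_mul]
      by_contra h
      exact hk (huniq k l (Or.inr hak) (Or.inr (left_ne_zero_of_mul h))
        (Or.inr (right_ne_zero_of_mul (right_ne_zero_of_mul h)))).1
    · simp
  have h1 : Matrix.diagonal (fun _ : Fin (d + 1) => (1 : K)) = 1 := Matrix.diagonal_one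
  have e1 := hthree (fun _ => 1) (fun _ => 1)
  have e2 := hthree (fun _ => 1) θ
  have e3 := hthree θ (fun _ => 1)
  simp only [h1, one_mul] at e1 e2 e3
  have f1 : (N * (N * (N * Matrix.diagonal θ))) a x = (N * (N * N)) a x * θ x := by
    rw [← Matrix.mul_diagonal]
    simp only [mul_assoc]
  have f2 : (N * (N * Matrix.diagonal θ)) a x = (N * N) a x * θ x := by
    rw [← Matrix.mul_diagonal, mul_assoc]
  have e := congrFun (congrFun hrel a) x
  simp only [Matrix.sub_apply, Matrix.add_apply, Matrix.smul_apply, smul_eq_mul, f1, f2, e1, e2, e3,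
    Matrix.diagonal_mul, Matrix.mul_diagonal, htwo, hax] at e
  apply mul_left_cancel₀ (mul_ne_zero (mul_ne_zero hab hbc') hcx)
  linear_combination e

/-- `g 0, …, g r` is a path in the graph `R` all of whose vertices but `g r` have no neighbours
except their neighbours on the path. Values of `g` beyond `r` are irrelevant. -/
structure IsInitialPath (R : Fin (d + 1) → Fin (d + 1) → Prop) (g : ℕ → Fin (d + 1)) (r : ℕ) :
    Prop where
  inj : ∀ m n, m ≤ r → n ≤ r → g m = g n → m = n
  adj : ∀ m, m < r → R (g m) (g (m + 1))
  nbr : ∀ m, m < r → ∀ k, R (g m) k → ∃ n, k = g n ∧ (n = m + 1 ∨ n + 1 = m)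

variable {R : Fin (d + 1) → Fin (d + 1) → Prop} {g : ℕ → Fin (d + 1)} {r : ℕ}

/-- Within the path, the last vertex is adjacent to its predecessor only. -/
lemma IsInitialPath.nbr_last (hg : IsInitialPath R g r) (hirr : ∀ i, ¬ R i i)
    (hsymm : ∀ i j, R i j → R j i) {n : ℕ} (hn : n ≤ r) (h : R (g r) (g n)) : n + 1 = r := by
  have hnr : n ≠ r := by
    rintro rfl
    exact hirr _ h
  obtain ⟨n', h1, h2⟩ := hg.nbr n (by omega) _ (hsymm _ _ h)
  have := hg.inj r n' le_rfl (by omega) h1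
  omega

/-- By connectedness some vertex of the path has a neighbour off the path; only the last one can. -/
lemma IsInitialPath.extend (hg : IsInitialPath R g r) (hirr : ∀ i, ¬ R i i)
    (hsymm : ∀ i j, R i j → R j i) (hr : r < d)
    (hconn : ∀ (S : Set (Fin (d + 1))) (x y : Fin (d + 1)), x ∈ S → y ∉ S →
      ∃ i ∈ S, ∃ j ∉ S, R i j)
    (huniq : ∀ x y, (∀ n ≤ r, x ≠ g n) → (∀ n ≤ r, y ≠ g n) → R (g r) x → R (g r) y → x = y) :
    ∃ g' : ℕ → Fin (d + 1), IsInitialPath R g' (r + 1) ∧ ∀ m ≤ r, g' m = g m := by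
  obtain ⟨y, hy⟩ : ∃ y, y ∉ (Finset.range (r + 1)).image g := by
    by_contra! h
    have h1 : (Finset.univ : Finset (Fin (d + 1))).card ≤ ((Finset.range (r + 1)).image g).card :=
      Finset.card_le_card fun y _ => h y
    have h2 := h1.trans Finset.card_image_le
    simp at h2
    omega
  obtain ⟨_, hm, k, hk, hmk⟩ := hconn ((Finset.range (r + 1)).image g : Finset _) (g 0) y
    (by simpa using ⟨0, by omega, rfl⟩) (by simpa using hy)
  simp only [Finset.coe_image, Finset.coe_range, Set.mem_image, Set.mem_Iio, Nat.lt_succ_iff,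
    not_exists, not_and] at hm hk
  obtain ⟨m, hmr, rfl⟩ := hm
  obtain rfl : m = r := by
    by_contra hne
    obtain ⟨n, h1, h2⟩ := hg.nbr m (by omega) k hmk
    exact hk n (by omega) h1.symm
  have hkm : ∀ n ≤ m, k ≠ g n := fun n hn h => hk n hn h.symm
  have hold : ∀ n ≤ m, Function.update g (m + 1) k n = g n := fun n hn =>
    Function.update_of_ne (by omega) _ _
  have hnew : Function.update g (m + 1) k (m + 1) = k := Function.update_self _ _ _
  refine ⟨Function.update g (m + 1) k, ⟨fun a b ha hb hab => ?_, fun a ha => ?_,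
    fun a ha x hx => ?_⟩, hold⟩
  · rcases Nat.le_succ_iff.1 ha with ha | rfl <;> rcases Nat.le_succ_iff.1 hb with hb | rfl
    · exact hg.inj a b ha hb (by rwa [hold a ha, hold b hb] at hab)
    · rw [hold a ha, hnew] at hab
      exact absurd hab.symm (hkm a ha)
    · rw [hold b hb, hnew] at hab
      exact absurd hab (hkm b hb)
    · rfl
  · rw [hold a (by omega)]
    rcases (Nat.lt_succ_iff.1 ha).eq_or_lt with rfl | ha'
    · rwa [hnew]
    · rw [hold _ (by omega)]
      exact hg.adj a ha'
  · rw [hold a (by omega)] at hx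
    rcases (Nat.lt_succ_iff.1 ha).eq_or_lt with rfl | ha'
    · by_cases hxg : ∃ n ≤ a, x = g n
      · obtain ⟨n, hn, rfl⟩ := hxg
        exact ⟨n, (hold n hn).symm, Or.inr (hg.nbr_last hirr hsymm hn hx)⟩
      · push Not at hxg
        exact ⟨a + 1, by rw [hnew]; exact huniq _ _ hxg hkm hx hmk, Or.inl rfl⟩
    · obtain ⟨n, rfl, h2⟩ := hg.nbr a ha' x hx
      exact ⟨n, (hold n (by omega)).symm, h2⟩

/-- A connected graph in which every initial path extends in at most one way is a path. -/
lemma exists_path_ordering (hd : 1 ≤ d) (hirr : ∀ i, ¬ R i i) (hsymm : ∀ i j, R i j → R j i)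
    (hconn : ∀ (S : Set (Fin (d + 1))) (x y : Fin (d + 1)), x ∈ S → y ∉ S →
      ∃ i ∈ S, ∃ j ∉ S, R i j)
    {i j : Fin (d + 1)} (hij : i ≠ j) (hi : ∀ k, R i k → k = j)
    (huniq : ∀ (g : ℕ → Fin (d + 1)) (r : ℕ), 1 ≤ r → g 0 = i → g 1 = j → IsInitialPath R g r →
      ∀ x y, (∀ n ≤ r, x ≠ g n) → (∀ n ≤ r, y ≠ g n) → R (g r) x → R (g r) y → x = y) :
    ∃ π : Fin (d + 1) → Fin (d + 1), Function.Bijective π ∧ π 0 = i ∧ π 1 = j ∧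
      ∀ m n, R (π m) (π n) ↔ ((m : ℕ) + 1 = n ∨ (n : ℕ) + 1 = m) := by
  have hRij : R i j := by
    obtain ⟨i', hi', k, -, hk⟩ := hconn {i} i j rfl (fun h => hij h.symm)
    rw [Set.mem_singleton_iff.1 hi'] at hk
    rwa [hi k hk] at hk
  have hpath : ∀ r, 1 ≤ r → r ≤ d → ∃ g, IsInitialPath R g r ∧ g 0 = i ∧ g 1 = j := by
    intro r hr
    induction r, hr using Nat.le_induction with
    | base =>
      intro _
      refine ⟨fun n => if n = 0 then i else j, ⟨fun m n hm hn h => ?_, fun m hm => ?_,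
        fun m hm k hk => ?_⟩, by simp, by simp⟩
      · interval_cases m <;> interval_cases n <;> simp_all
      · obtain rfl : m = 0 := by omega
        simpa using hRij
      · obtain rfl : m = 0 := by omega
        exact ⟨1, by simpa using hi k (by simpa using hk), Or.inl rfl⟩
    | succ r hr ih =>
      intro hrd
      obtain ⟨g, hg, h0, h1⟩ := ih (by omega)
      obtain ⟨g', hg', hold⟩ := hg.extend hirr hsymm (by omega) hconn (huniq g r hr h0 h1 hg)
      exact ⟨g', hg', by rw [hold 0 (by omega), h0], by rw [hold 1 hr, h1]⟩
  obtain ⟨g, hg, h0, h1⟩ := hpath d hd le_rfl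
  have hinj : Function.Injective fun m : Fin (d + 1) => g m := fun m n h =>
    Fin.ext (hg.inj m n (by omega) (by omega) h)
  refine ⟨fun m => g m, ⟨hinj, Finite.surjective_of_injective hinj⟩, h0, ?_, fun m n => ⟨fun h => ?_,
    ?_⟩⟩
  · have : ((1 : Fin (d + 1)) : ℕ) = 1 := by
      rw [Fin.val_one', Nat.mod_eq_of_lt (by omega)]
    simpa only [this] using h1
  · by_cases hm : (m : ℕ) < d
    · obtain ⟨n', h2, h3⟩ := hg.nbr m hm _ h
      have := hg.inj n n' (by omega) (by omega) h2
      omega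
    · have hmd : (m : ℕ) = d := by omega
      simp only [hmd] at h
      exact Or.inr ((hg.nbr_last hirr hsymm (by omega) h).trans hmd.symm)
  · rintro (h | h)
    · have := hg.adj m (by omega)
      rwa [h] at this
    · have := hg.adj n (by omega)
      rw [h] at this
      exact hsymm _ _ this

/-- The tridiagonal relation makes the extension of a path beyond its third vertex unique. -/
lemma IsInitialPath.eigenvalue_eq {N : Matrix (Fin (d + 1)) (Fin (d + 1)) K}
    {θ : Fin (d + 1) → K} {β γ ρ : K}
    (hrel : N * (N * (N * Matrix.diagonal θ)) - (β + 1) • (N * (N * (Matrix.diagonal θ * N))) +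
        (β + 1) • (N * (Matrix.diagonal θ * (N * N))) - Matrix.diagonal θ * (N * (N * N)) =
      γ • (N * (N * Matrix.diagonal θ) - Matrix.diagonal θ * (N * N)) +
        ρ • (N * Matrix.diagonal θ - Matrix.diagonal θ * N))
    (hg : IsInitialPath (fun i j => i ≠ j ∧ N i j ≠ 0) g (r + 2)) {x : Fin (d + 1)}
    (hx : ∀ n ≤ r + 2, x ≠ g n) (hgx : N (g (r + 2)) x ≠ 0) :
    θ x = (β + 1) * θ (g (r + 2)) - (β + 1) * θ (g (r + 1)) + θ (g r) := by
  have hstep : ∀ m < r + 2, ∀ k, g m = k ∨ N (g m) k ≠ 0 → ∃ n ≤ m + 1, k = g n := by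
    intro m hm k hk
    by_cases hmk : g m = k
    · exact ⟨m, by omega, hmk.symm⟩
    · obtain ⟨n, h1, h2⟩ := hg.nbr m hm k ⟨hmk, hk.resolve_left hmk⟩
      exact ⟨n, by omega, h1⟩
  refine eigenvalue_eq_of_unique_walk hrel (hg.adj (r + 1) (by omega)).1 (hg.adj r (by omega)).2
    (hg.adj (r + 1) (by omega)).2 hgx fun k l hk hl hlx => ?_
  obtain ⟨n₁, hn₁, rfl⟩ := hstep r (by omega) k hk
  obtain ⟨n₂, hn₂, rfl⟩ := hstep n₁ (by omega) l hl
  have h2 : n₂ = r + 2 := by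
    by_contra hne
    obtain ⟨n₃, hn₃, h3⟩ := hstep n₂ (by omega) x hlx
    exact hx n₃ (by omega) h3
  have h1 : n₁ = r + 1 := by omega
  exact ⟨by rw [h1], by rw [h2]⟩

/-! ### `Q`-polynomial orderings -/

lemma IsAdapted.injective {u : Module.Basis (Fin (d + 1)) K V}
    {E : Fin (d + 1) → Module.End K V} (hu : IsAdapted u E) : Function.Injective E := by
  intro i k h
  by_contra hik
  have h1 := congrArg (fun X => X (u i)) h
  simp only [hu i i, hu k i, if_true, if_neg (Ne.symm hik)] at h1
  exact u.ne_zero i h1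

/-- Two orderings of the primitive idempotents have the same members. -/
lemma exists_eq_of_orderings {A : Module.End K V} {E G : Fin (d + 1) → Module.End K V}
    (hV : Module.finrank K V = d + 1) (hE : IsPrimitiveIdempotentOrdering A E)
    (hG : IsPrimitiveIdempotentOrdering A G) (k : Fin (d + 1)) : ∃ m, E k = G m := by
  obtain ⟨θ, hθ, hθr, hθE⟩ := hE
  obtain ⟨θ', -, hθr', hθG⟩ := hG
  obtain ⟨m, hm⟩ : θ k ∈ Set.range θ' := by rw [hθr', ← hθr]; exact ⟨k, rfl⟩
  obtain ⟨u, hu, hA⟩ := exists_adapted_eigenbasis hV hθ hθE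
  refine ⟨m, u.ext fun j => ?_⟩
  have hj := Module.End.mem_eigenspace_iff.2 (hA j)
  by_cases h : θ j = θ k
  · rw [(hθE k).apply_self _ (h ▸ hj), (hθG m).apply_self _ (hm ▸ h ▸ hj)]
  · rw [(hθE k).apply_other _ h _ hj, (hθG m).apply_other _ (hm ▸ h) _ hj]

lemma IsIrreducibleTridiagonal.le_of_ne_zero {E : Fin (d + 1) → Module.End K V}
    {X : Module.End K V} (h : IsIrreducibleTridiagonal E X) {i j : Fin (d + 1)}
    (hij : E i * X * E j ≠ 0) : (j : ℕ) ≤ i + 1 := by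
  by_contra hlt
  refine hij ((h i j).1 ?_)
  rw [lt_abs]
  omega

/-- The first two idempotents of a `Q`-polynomial ordering form a tail. -/
lemma IsLeonardSystem.isTail (hd : 1 ≤ d) (hV : Module.finrank K V = d + 1)
    {A Astar : Module.End K V} {E G Estar : Fin (d + 1) → Module.End K V}
    (hE : IsPrimitiveIdempotentOrdering A E) (hG : IsLeonardSystem A G Astar Estar)
    {i j : Fin (d + 1)} (h0 : G 0 = E i) (h1 : G 1 = E j) : IsTail E Astar i j := by
  have hval : ((1 : Fin (d + 1)) : ℕ) = 1 := by
    rw [Fin.val_one', Nat.mod_eq_of_lt (by omega)]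
  obtain ⟨θ, hθ, -, hθE⟩ := id hE
  obtain ⟨u, hu, -⟩ := exists_adapted_eigenbasis hV hθ hθE
  have hex := exists_eq_of_orderings hV hE hG.ordering
  refine ⟨fun k hk => ?_, fun k l hk hki hl hli => ?_⟩
  · obtain ⟨m, hm⟩ := hex k
    have hle := hG.tridiagonal_star.le_of_ne_zero (i := 0) (j := m) (by rw [h0, ← hm]; exact hk.2)
    have hm0 : m ≠ 0 := by
      rintro rfl
      exact hk.1 (hu.injective (h0.symm.trans hm.symm))
    have hm1 : m = 1 := Fin.ext (by
      have := Fin.val_ne_of_ne hm0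
      rw [Fin.val_zero] at this hle
      omega)
    exact hu.injective (by rw [hm, hm1, h1])
  · have key : ∀ k, DeltaAdj E Astar j k → k ≠ i → ∃ m : Fin (d + 1), E k = G m ∧ (m : ℕ) = 2 := by
      intro k hk hki
      obtain ⟨m, hm⟩ := hex k
      have hle := hG.tridiagonal_star.le_of_ne_zero (i := 1) (j := m)
        (by rw [h1, ← hm]; exact hk.2)
      have hm0 : m ≠ 0 := by
        rintro rfl
        exact hki (hu.injective (hm.trans h0))
      have hm1 : m ≠ 1 := by
        rintro rfl
        exact hk.1 (hu.injective (h1.symm.trans hm.symm))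
      have e0 := Fin.val_ne_of_ne hm0
      have e1 := Fin.val_ne_of_ne hm1
      rw [Fin.val_zero] at e0
      exact ⟨m, hm, by omega⟩
    obtain ⟨m, hm, hm2⟩ := key k hk hki
    obtain ⟨m', hm', hm2'⟩ := key l hl hli
    obtain rfl : m = m' := Fin.ext (hm2.trans hm2'.symm)
    exact hu.injective (hm.trans hm'.symm)

/-- An ordering of the idempotents of `A` along which `A*` is irreducible tridiagonal is
`Q`-polynomial. -/
lemma isLeonardSystem_of_tridiagonal (hV : Module.finrank K V = d + 1)
    {b : Module.Basis (Fin (d + 1)) K V} {A Astar : Module.End K V}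
    {G Estar : Fin (d + 1) → Module.End K V} {t : Fin (d + 1) → K} (hb : IsAdapted b Estar)
    (hAs : ∀ j, Astar (b j) = t j • b j) (hA : IsMultiplicityFree A)
    (hG : IsPrimitiveIdempotentOrdering A G) (hAEstar : IsIrreducibleTridiagonal Estar A)
    (hAsG : IsIrreducibleTridiagonal G Astar) : IsLeonardSystem A G Astar Estar := by
  obtain ⟨θ, hθ, -, hθG⟩ := id hG
  obtain ⟨u, hu, -⟩ := exists_adapted_eigenbasis hV hθ hθG
  have ht := injective_of_isLowerHessenberg hAs ((hu.tridiagonal_iff _).1 hAsG).isLowerHessenberg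
  have hev := hasEigenvalue_iff_of_eigenbasis hAs
  exact
    { multiplicityFree := hA
      multiplicityFree_star := ⟨fun k => t (Fin.cast hV k),
        ht.comp (Fin.cast_injective hV), fun k => (hev _).2 ⟨_, rfl⟩⟩
      ordering := hG
      ordering_star := ⟨t, ht, Set.ext fun μ => (hev μ).symm, hb.isPrimitiveIdempotent hAs ht⟩
      tridiagonal := hAEstar
      tridiagonal_star := hAsG }

end LeonardTail

open LeonardTail in
theorem mainTheorem1 {K V : Type*} [Field K] [AddCommGroup V] [Module K V]
    (d : ℕ) (hd : 1 ≤ d) (hV : Module.finrank K V = d + 1)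
    (A : Module.End K V) (Estar : Fin (d + 1) → Module.End K V)
    (hEstar : LeonardTail.IsOrthogonalIdempotentSystem Estar)
    (hAEstar : LeonardTail.IsIrreducibleTridiagonal Estar A)
    (hA : LeonardTail.IsMultiplicityFree A)
    (E : Fin (d + 1) → Module.End K V)
    (hE : LeonardTail.IsPrimitiveIdempotentOrdering A E)
    (θstar : Fin (d + 1) → K)
    (Astar : Module.End K V) (hAstar : Astar = LeonardTail.dualMap θstar Estar)
    (i j : Fin (d + 1)) (hij : i ≠ j) :
    LeonardTail.IsQPolynomialPair A Astar Estar (E i) (E j) ↔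
      LeonardTail.IsTail E Astar i j ∧
      (∃ β γ : K, ∀ (h : ℕ) (_ : 1 ≤ h) (_ : h ≤ d - 1),
        θstar ⟨h - 1, by omega⟩ - β * θstar ⟨h, by omega⟩ + θstar ⟨h + 1, by omega⟩ = γ) ∧
      (∀ h : Fin (d + 1), h ≠ 0 → θstar 0 ≠ θstar h) := by
  obtain ⟨b, hb⟩ := hEstar.exists_adapted hV
  have hAs : ∀ k, Astar (b k) = θstar k • b k := fun k => by rw [hAstar, dualMap_apply_basis hb]
  have hM := (hb.tridiagonal_iff A).1 hAEstar
  constructor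
  · rintro ⟨G, hG, h0, h1⟩
    obtain ⟨θ, hθ, -, hθG⟩ := hG.ordering
    obtain ⟨u, hu, huA⟩ := exists_adapted_eigenbasis hV hθ hθG
    have hN := ((hu.tridiagonal_iff Astar).1 hG.tridiagonal_star).isLowerHessenberg
    exact ⟨hG.isTail hd hV hE h0 h1, exists_isRecurrent hAs hM huA hθ hN,
      fun h hh => (injective_of_isLowerHessenberg hAs hN).ne hh.symm⟩
  · rintro ⟨htail, ⟨β, γ, hrec⟩, ht0⟩
    obtain ⟨θ, hθ, hθr, hθE⟩ := id hE
    obtain ⟨u, hu, huA⟩ := exists_adapted_eigenbasis hV hθ hθE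
    have hsymm : ∀ k l, mat u Astar k l = 0 → mat u Astar l k = 0 := fun k l =>
      mat_eq_zero_symm hAs hM huA hθ hu
    obtain ⟨ρ, hrel⟩ := IsRecurrent.tridiagonal_relation hAs hM hrec
    have hrelN := congrArg (mat u) hrel
    simp only [map_sub, map_add, map_mul, map_smul, mat_eq_diagonal huA] at hrelN
    have hadj : ∀ k l, DeltaAdj E Astar k l ↔ k ≠ l ∧ mat u Astar k l ≠ 0 := fun k l => by
      rw [DeltaAdj, ne_eq (E k * Astar * E l), hu.mul_mul_eq_zero_iff]
    obtain ⟨π, hπ, hπ0, hπ1, hπR⟩ := exists_path_ordering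
      (R := fun k l => k ≠ l ∧ mat u Astar k l ≠ 0) hd (fun k h => h.1 rfl)
      (fun k l h => ⟨h.1.symm, fun h' => h.2 (hsymm l k h')⟩)
      (fun S x y hx hy => by
        obtain ⟨k, hk, l, hl, hkl⟩ :=
          exists_mat_ne_zero_of_mem_of_notMem hAs ht0 hM huA hsymm hx hy
        exact ⟨k, hk, l, hl, fun h => hl (h ▸ hk), hkl⟩)
      hij (fun k hk => htail.1 k ((hadj i k).2 hk))
      (fun g r hr h0 h1 hg x y hx hy hgx hgy => by
        rcases r with _ | _ | r
        · omega
        · -- the second vertex has a unique further neighbour by the definition of a tail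
          rw [zero_add, h1, ← hadj] at hgx hgy
          exact htail.2 x y hgx (h0 ▸ hx 0 (by omega)) hgy (h0 ▸ hy 0 (by omega))
        · exact hθ ((hg.eigenvalue_eq hrelN hx hgx.2).trans
            (hg.eigenvalue_eq hrelN hy hgy.2).symm))
    refine ⟨fun m => E (π m), isLeonardSystem_of_tridiagonal hV hb hAs hA
      ⟨θ ∘ π, hθ.comp hπ.1, by rw [hπ.2.range_comp, hθr], fun m => hθE (π m)⟩ hAEstar
      fun m n => ?_, by simp only [hπ0], by simp only [hπ1]⟩
    rw [ne_eq (E (π m) * Astar * E (π n)), hu.mul_mul_eq_zero_iff]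
    have hR := hπR m n
    refine ⟨fun h => ?_, fun h => ?_⟩
    · rw [lt_abs] at h
      by_contra hne
      have hmn : π m ≠ π n := fun h' => by
        rw [hπ.1 h'] at h
        omega
      have := hR.1 ⟨hmn, hne⟩
      omega
    · rw [abs_eq one_pos.le] at h
      exact (hR.2 (by omega)).2
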